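/- An abelian heap is a (possibly empty) set $H$ with a ternary operation satisfying $[[a,b,c],d,e]=[a,b,[c,d,e]]$, $[a,b,b]=a=[b,b,a]$ and $[a,b,c]=[c,b,a]$; $\mathbf{Ah}$ is the category of abelian heaps and maps preserving the operation, $\star=\{*\}$ is the one-element heap, and $[a_1,\dots,a_{2k+1}]$ denotes the iterated bracket. A truss $T$ is an abelian heap with an associative multiplication distributing over $[-,-,-]$ on both sides. A left $T$-module is an abelian heap $M$ with an associative action of $T$ distributing over the brackets of $T$ and of $M$ (no unitality is required), and right modules are defined symmetrically. $T\text{-}\mathbf{mod}$ is the category of left $T$-modules and action-preserving heap morphisms; $\mathrm{Hom}_T(M,N)$ is an abelian heap pointwise. Let $\overline{T}=T\boxplus\star$ be the unital extension of $T$: the coproduct of abelian heaps, with the unique truss multiplication that extends that of $T$ and has identity $*$. Every $T$-module is canonically a unital $\overline{T}$-module, and $\overline T$ is a $T$-$T$-bimodule through $T\to\overline T$. For a left $T$-module $P$ put ${}^*P=\mathrm{Hom}_T(P,\overline{T})$, a right $T$-module via $(f\cdot t)(p)=f(p)t$. For a right $T$-module $M$ and a left $T$-module $N$, $M\otimes_T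 N$ is the abelian heap representing bilinear maps $\varphi$ on $M\times N$ with $\varphi(m\cdot t,n)=\varphi(m,t\cdot n)$; $\otimes$ is the tensor product of abelian heaps (over $\star$). **Theorem.** Let $T$ be a truss and $P$ a left $T$-module. The following are equivalent: 1. The functor $\mathrm{Hom}_T(P,-):T\text{-}\mathbf{mod}\to\mathbf{Ah}$ is right exact (it preserves finite colimits) and $P$ is finitely generated. 2. $P$ has a finite dual basis: there are $k\ge 0$, $e_1,\dots,e_{2k+1}\in P$ and $\phi_1,\dots,\phi_{2k+1}\in{}^*P$ such that $p=[\phi_1(p)\cdot e_1,\dots,\phi_{2k+1}(p)\cdot e_{2k+1}]$ for all $p\in P$. 3. There are a $T$-bilinear morphism $\mathsf{ev}:P\otimes{}^*P\to\overline{T}$ and a morphism of abelian heaps $\mathsf{db}:\star\to{}^*P\otimes_T P$ such that $$(\mathsf{ev}\otimes_T P)\circ(P\otimes\mathsf{db})=\mathrm{id}_P,\qquad({}^*P\otimes_T\mathsf{ev})\circ(\mathsf{db}\otimes{}^*P)=\mathrm{id}_{{}^*P},$$ up to the associativity isomorphisms and the canonical isomorphisms $P\otimes\star\cong P\cong\overline{T}\otimes_T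 P$ and ${}^*P\otimes_T\overline{T}\cong{}^*P\cong\star\otimes{}^*P$. 4. The functor $\mathrm{Hom}_T(P,-):T\text{-}\mathbf{mod}\to\mathbf{Ah}$ is naturally isomorphic to ${}^*P\otimes_T-$. 5. The functor $\mathrm{Hom}_T(P,-)$ is cocontinuous (it preserves small colimits). Modules $P$ satisfying these conditions are called tiny (or small-projective). -/

import Mathlib

universe u v w x y z

namespace Trusses

open MulOpposite

/-! ### Abelian heaps -/

/-- An abelian heap: a (possibly empty) type with a ternary operation `[a, b, c]` that is
associative, satisfies the Mal'cev identities, and is commutative. -/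
class AbHeap (H : Type u) where
  br : H → H → H → H
  br_assoc : ∀ a b c d e : H, br (br a b c) d e = br a b (br c d e)
  br_right : ∀ a b : H, br a b b = a
  br_left : ∀ a b : H, br b b a = a
  br_comm : ∀ a b c : H, br a b c = br c b a

open AbHeap

section HeapLemmas

variable {H : Type u} [AbHeap H]

theorem br_mid (a b c d e : H) : br a (br d c b) e = br (br a b c) d e := by
  have h : br (br a b c) d (br d c b) = a := by
    rw [← br_assoc (br a b c), br_right, br_assoc, br_left, br_right]
  calc br a (br d c b) e = br (br (br a b c) d (br d c b)) (br d c b) e := by rw [h]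
    _ = br (br a b c) d e := by rw [br_assoc, br_left]

theorem br_swap_odd (p q r s t : H) : br (br p q r) s t = br (br p q t) s r := by
  rw [br_assoc, br_comm r, ← br_assoc]

theorem br_swap_even (p q r s t : H) : br (br p q r) s t = br (br p s r) q t := by
  rw [← br_mid, br_comm s, br_mid]

theorem br_swap (p q r s t : H) : br (br p q r) s t = br (br p s t) q r := by
  rw [br_swap_odd, br_swap_even]

/-- The transposition rule. -/
theorem br_transpose (a₁ a₂ a₃ b₁ b₂ b₃ c₁ c₂ c₃ : H) :
    br (br a₁ a₂ a₃) (br b₁ b₂ b₃) (br c₁ c₂ c₃) =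
      br (br a₁ b₁ c₁) (br a₂ b₂ c₂) (br a₃ b₃ c₃) := by
  rw [br_mid, br_mid, ← br_assoc (br (br a₁ a₂ a₃) b₃ b₂),
    ← br_assoc (br (br a₁ b₁ c₁) c₂ b₂), br_swap _ b₃ b₂ b₁ c₁,
    br_swap a₁ a₂ a₃ b₁ c₁, br_swap_even _ b₃ b₂ c₂ c₃, br_swap _ a₂ a₃ c₂ b₂]

/-- The value `[a₀, a₁, …, a₂ₖ]` of a bracket of odd length `2k + 1`. -/
def oddBr : (k : ℕ) → (Fin (2 * k + 1) → H) → H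
  | 0, a => a 0
  | k + 1, a =>
      br (oddBr k fun i => a ⟨i.1, by omega⟩) (a ⟨2 * k + 1, by omega⟩) (a ⟨2 * k + 2, by omega⟩)

end HeapLemmas

/-- The terminal heap `⋆`. -/
instance : AbHeap Unit where
  br _ _ _ := ()
  br_assoc _ _ _ _ _ := rfl
  br_right _ _ := rfl
  br_left _ _ := rfl
  br_comm _ _ _ := rfl

/-- Morphisms of heaps. -/
structure HeapHom (A : Type u) (B : Type v) [AbHeap A] [AbHeap B] where
  toFun : A → B
  map_br' : ∀ a b c, toFun (br a b c) = br (toFun a) (toFun b) (toFun c)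

namespace HeapHom

variable {A : Type u} {B : Type v} {C : Type w} {D : Type x}
  [AbHeap A] [AbHeap B] [AbHeap C] [AbHeap D]

instance : FunLike (HeapHom A B) A B where
  coe := toFun
  coe_injective f g h := by cases f; cases g; congr

@[ext] theorem ext {f g : HeapHom A B} (h : ∀ a, f a = g a) : f = g := DFunLike.ext f g h

@[simp] theorem mk_apply (f : A → B) (h) (a : A) : HeapHom.mk f h a = f a := rfl

@[simp] theorem map_br (f : HeapHom A B) (a b c : A) : f (br a b c) = br (f a) (f b) (f c) :=
  f.map_br' a b c

/-- Homomorphism sets of abelian heaps are abelian heaps under the pointwise operation. -/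
instance : AbHeap (HeapHom A B) where
  br f g h := ⟨fun a => br (f a) (g a) (h a), fun a b c => by
    simp only [map_br]; exact br_transpose _ _ _ _ _ _ _ _ _⟩
  br_assoc _ _ _ _ _ := ext fun _ => br_assoc _ _ _ _ _
  br_right _ _ := ext fun _ => br_right _ _
  br_left _ _ := ext fun _ => br_left _ _
  br_comm _ _ _ := ext fun _ => br_comm _ _ _

@[simp] theorem br_apply (f g h : HeapHom A B) (a : A) : br f g h a = br (f a) (g a) (h a) := rfl

/-- The identity morphism. -/
def id (A : Type u) [AbHeap A] : HeapHom A A := ⟨fun a => a, fun _ _ _ => rfl⟩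

@[simp] theorem id_apply (a : A) : id A a = a := rfl

/-- Composition `g ∘ f`. -/
def comp (g : HeapHom B C) (f : HeapHom A B) : HeapHom A C :=
  ⟨fun a => g (f a), fun a b c => by simp⟩

@[simp] theorem comp_apply (g : HeapHom B C) (f : HeapHom A B) (a : A) : comp g f a = g (f a) := rfl

/-- The constant morphism. -/
def const (A : Type u) [AbHeap A] (b : B) : HeapHom A B := ⟨fun _ => b, fun _ _ _ => (br_left b b).symm⟩

@[simp] theorem const_apply (a : A) (b : B) : const A b a = b := rfl

end HeapHom

/-! ### Abelian heaps given by generators and relations -/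

/-- Formal heap words in an alphabet `X`. -/
inductive HeapWord (X : Type u) : Type u
  | of : X → HeapWord X
  | br : HeapWord X → HeapWord X → HeapWord X → HeapWord X

/-- The smallest congruence on heap words that contains `r` and the axioms of an abelian heap. -/
inductive HeapCong {X : Type u} (r : HeapWord X → HeapWord X → Prop) :
    HeapWord X → HeapWord X → Prop
  | rel {a b} : r a b → HeapCong r a b
  | refl (a) : HeapCong r a a
  | symm {a b} : HeapCong r a b → HeapCong r b a
  | trans {a b c} : HeapCong r a b → HeapCong r b c → HeapCong r a c
  | congr {a a' b b' c c'} : HeapCong r a a' → HeapCong r b b' → HeapCong r c c' →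
      HeapCong r (.br a b c) (.br a' b' c')
  | assoc (a b c d e) : HeapCong r (.br (.br a b c) d e) (.br a b (.br c d e))
  | right (a b) : HeapCong r (.br a b b) a
  | left (a b) : HeapCong r (.br b b a) a
  | comm (a b c) : HeapCong r (.br a b c) (.br c b a)

/-- The congruence as a setoid. -/
def heapSetoid {X : Type u} (r : HeapWord X → HeapWord X → Prop) : Setoid (HeapWord X) :=
  ⟨HeapCong r, HeapCong.refl, HeapCong.symm, HeapCong.trans⟩

/-- The abelian heap generated by `X` subject to the relations `r`: the quotient of the free
abelian heap on `X` by the congruence generated by `r`. -/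
def Presented {X : Type u} (r : HeapWord X → HeapWord X → Prop) : Type u := Quotient (heapSetoid r)

namespace Presented

variable {X : Type u} {r : HeapWord X → HeapWord X → Prop}

instance : AbHeap (Presented r) where
  br x := Quotient.lift
    (fun a => Quotient.map₂ (HeapWord.br a) fun _ _ h₂ _ _ h₃ => HeapCong.congr (.refl a) h₂ h₃)
    (fun a a' h => by
      funext y z
      obtain ⟨b⟩ := y; obtain ⟨c⟩ := z
      exact Quotient.sound (HeapCong.congr h (.refl b) (.refl c))) x
  br_assoc := by
    rintro ⟨a⟩ ⟨b⟩ ⟨c⟩ ⟨d⟩ ⟨e⟩; exact Quotient.sound (HeapCong.assoc a b c d e)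
  br_right := by rintro ⟨a⟩ ⟨b⟩; exact Quotient.sound (HeapCong.right a b)
  br_left := by rintro ⟨a⟩ ⟨b⟩; exact Quotient.sound (HeapCong.left a b)
  br_comm := by rintro ⟨a⟩ ⟨b⟩ ⟨c⟩; exact Quotient.sound (HeapCong.comm a b c)

/-- The class of a word. -/
def mk (r : HeapWord X → HeapWord X → Prop) (a : HeapWord X) : Presented r :=
  Quotient.mk (heapSetoid r) a

/-- The class of a generator. -/
def gen (r : HeapWord X → HeapWord X → Prop) (a : X) : Presented r := mk r (.of a)

theorem mk_br (a b c : HeapWord X) : mk r (.br a b c) = br (mk r a) (mk r b) (mk r c) := rfl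

theorem mk_eq {a b : HeapWord X} (h : r a b) : mk r a = mk r b := Quotient.sound (HeapCong.rel h)

theorem induction {p : Presented r → Prop} (hgen : ∀ a, p (gen r a))
    (hbr : ∀ a b c, p a → p b → p c → p (br a b c)) (z : Presented r) : p z := by
  obtain ⟨z⟩ := z
  induction z with
  | of a => exact hgen a
  | br a b c ha hb hc => exact hbr _ _ _ ha hb hc

variable {H : Type v} [AbHeap H]

/-- Evaluation of heap words in an abelian heap. -/
def evalWord (f : X → H) : HeapWord X → H
  | .of a => f a
  | .br a b c => br (evalWord f a) (evalWord f b) (evalWord f c)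

theorem evalWord_eq (f : X → H) (hf : ∀ a b, r a b → evalWord f a = evalWord f b)
    {a b : HeapWord X} (h : HeapCong r a b) : evalWord f a = evalWord f b := by
  induction h with
  | rel h => exact hf _ _ h
  | refl => rfl
  | symm _ ih => exact ih.symm
  | trans _ _ ih₁ ih₂ => exact ih₁.trans ih₂
  | congr _ _ _ h₁ h₂ h₃ => simp only [evalWord, h₁, h₂, h₃]
  | assoc => exact br_assoc _ _ _ _ _
  | right => exact br_right _ _
  | left => exact br_left _ _
  | comm => exact br_comm _ _ _

/-- The universal property of a presented heap. -/
def lift (f : X → H) (hf : ∀ a b, r a b → evalWord f a = evalWord f b) : HeapHom (Presented r) H where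
  toFun := Quotient.lift (evalWord f) fun _ _ h => evalWord_eq f hf h
  map_br' := by rintro ⟨a⟩ ⟨b⟩ ⟨c⟩; rfl

@[simp] theorem lift_gen (f : X → H) (hf) (a : X) : lift (r := r) f hf (gen r a) = f a := rfl

theorem hom_ext {f g : HeapHom (Presented r) H} (h : ∀ a, f (gen r a) = g (gen r a)) : f = g :=
  HeapHom.ext fun z => induction (p := fun z => f z = g z) h
    (fun a b c ha hb hc => by simp [ha, hb, hc]) z

end Presented

/-! ### The direct sum (coproduct) of two abelian heaps -/

/-- The defining relations of `M ⊞ N`: brackets of letters from the same summand are evaluated. -/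
inductive SumRel (M : Type u) (N : Type v) [AbHeap M] [AbHeap N] :
    HeapWord (M ⊕ N) → HeapWord (M ⊕ N) → Prop
  | inl (m m' m'' : M) : SumRel M N (.of (.inl (br m m' m'')))
      (.br (.of (.inl m)) (.of (.inl m')) (.of (.inl m'')))
  | inr (n n' n'' : N) : SumRel M N (.of (.inr (br n n' n'')))
      (.br (.of (.inr n)) (.of (.inr n')) (.of (.inr n'')))

/-- The direct sum `M ⊞ N` of abelian heaps. -/
abbrev HeapSum (M : Type u) (N : Type v) [AbHeap M] [AbHeap N] : Type (max u v) :=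
  Presented (SumRel M N)

namespace HeapSum

variable {M : Type u} {N : Type v} {H : Type w} [AbHeap M] [AbHeap N] [AbHeap H]

/-- The first coproduct injection. -/
def inl : HeapHom M (HeapSum M N) :=
  ⟨fun m => Presented.gen _ (.inl m), fun a b c => Presented.mk_eq (SumRel.inl a b c)⟩

/-- The second coproduct injection. -/
def inr : HeapHom N (HeapSum M N) :=
  ⟨fun n => Presented.gen _ (.inr n), fun a b c => Presented.mk_eq (SumRel.inr a b c)⟩

theorem induction {p : HeapSum M N → Prop} (hl : ∀ m, p (inl m)) (hr : ∀ n, p (inr n))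
    (hbr : ∀ a b c, p a → p b → p c → p (br a b c)) (z : HeapSum M N) : p z :=
  Presented.induction (fun | .inl m => hl m | .inr n => hr n) hbr z

/-- The universal property of the coproduct. -/
def lift (f : HeapHom M H) (g : HeapHom N H) : HeapHom (HeapSum M N) H :=
  Presented.lift (Sum.elim f g) (by
    rintro _ _ (⟨a, b, c⟩ | ⟨a, b, c⟩)
    · exact f.map_br a b c
    · exact g.map_br a b c)

@[simp] theorem lift_inl (f : HeapHom M H) (g : HeapHom N H) (m : M) : lift f g (inl m) = f m := rfl

@[simp] theorem lift_inr (f : HeapHom M H) (g : HeapHom N H) (n : N) : lift f g (inr n) = g n := rfl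

theorem hom_ext {f g : HeapHom (HeapSum M N) H} (hl : ∀ m, f (inl m) = g (inl m))
    (hr : ∀ n, f (inr n) = g (inr n)) : f = g :=
  Presented.hom_ext fun | .inl m => hl m | .inr n => hr n

end HeapSum

/-! ### Trusses and their modules -/

/-- A truss (not necessarily unital, possibly empty): an abelian heap with an associative
multiplication that distributes over the ternary operation on both sides. -/
class Truss (T : Type u) extends AbHeap T, Semigroup T where
  mul_br : ∀ s a b c : T, s * br a b c = br (s * a) (s * b) (s * c)
  br_mul : ∀ s a b c : T, br a b c * s = br (a * s) (b * s) (c * s)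

instance {H : Type u} [AbHeap H] : AbHeap Hᵐᵒᵖ where
  br a b c := op (br a.unop b.unop c.unop)
  br_assoc _ _ _ _ _ := congrArg op (br_assoc _ _ _ _ _)
  br_right _ _ := congrArg op (br_right _ _)
  br_left _ _ := congrArg op (br_left _ _)
  br_comm _ _ _ := congrArg op (br_comm _ _ _)

/-- The opposite truss. -/
instance {T : Type u} [Truss T] : Truss Tᵐᵒᵖ where
  mul_br _ _ _ _ := congrArg op (Truss.br_mul _ _ _ _)
  br_mul _ _ _ _ := congrArg op (Truss.mul_br _ _ _ _)

/-- A left module over a truss `T` (no unitality is required).  As usual, a right `T`-module is a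
left module over the opposite truss `Tᵐᵒᵖ`, with `m · t` written `op t • m`. -/
class TMod (T : Type u) (M : Type v) [Truss T] [AbHeap M] extends SemigroupAction T M where
  br_smul : ∀ (a b c : T) (m : M), br a b c • m = br (a • m) (b • m) (c • m)
  smul_br : ∀ (t : T) (a b c : M), t • br a b c = br (t • a) (t • b) (t • c)

/-- Morphisms of left `T`-modules. -/
structure LinHom (T : Type u) (M : Type v) (N : Type w) [Truss T] [AbHeap M] [AbHeap N]
    [TMod T M] [TMod T N] extends HeapHom M N where
  map_smul' : ∀ (t : T) (m : M), toFun (t • m) = t • toFun m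

namespace LinHom

variable {T : Type u} {M : Type v} {N : Type w} {K : Type x} [Truss T] [AbHeap M] [AbHeap N]
  [AbHeap K] [TMod T M] [TMod T N] [TMod T K]

instance : FunLike (LinHom T M N) M N where
  coe f := f.toFun
  coe_injective f g h := by
    obtain ⟨⟨f, _⟩, _⟩ := f; obtain ⟨⟨g, _⟩, _⟩ := g; congr

@[ext] theorem ext {f g : LinHom T M N} (h : ∀ a, f a = g a) : f = g := DFunLike.ext f g h

@[simp] theorem mk_apply (f : HeapHom M N) (h) (a : M) : (LinHom.mk f h : LinHom T M N) a = f a := rfl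

@[simp] theorem toHeapHom_apply (f : LinHom T M N) (a : M) : f.toHeapHom a = f a := rfl

@[simp] theorem map_br (f : LinHom T M N) (a b c : M) : f (br a b c) = br (f a) (f b) (f c) :=
  f.map_br' a b c

@[simp] theorem map_smul (f : LinHom T M N) (t : T) (a : M) : f (t • a) = t • f a :=
  f.map_smul' t a

/-- The heap `Hom_T(M, N)`, with the pointwise operation. -/
instance : AbHeap (LinHom T M N) where
  br f g h := ⟨br f.toHeapHom g.toHeapHom h.toHeapHom, fun t m => by
    change br (f (t • m)) (g (t • m)) (h (t • m)) = t • br (f m) (g m) (h m)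
    simp [TMod.smul_br]⟩
  br_assoc _ _ _ _ _ := ext fun _ => br_assoc _ _ _ _ _
  br_right _ _ := ext fun _ => br_right _ _
  br_left _ _ := ext fun _ => br_left _ _
  br_comm _ _ _ := ext fun _ => br_comm _ _ _

@[simp] theorem br_apply (f g h : LinHom T M N) (a : M) : br f g h a = br (f a) (g a) (h a) := rfl

/-- The identity morphism. -/
def id (T : Type u) (M : Type v) [Truss T] [AbHeap M] [TMod T M] : LinHom T M M :=
  ⟨HeapHom.id M, fun _ _ => rfl⟩

@[simp] theorem id_apply (a : M) : id T M a = a := rfl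

/-- Composition `g ∘ f`. -/
def comp (g : LinHom T N K) (f : LinHom T M N) : LinHom T M K :=
  ⟨g.toHeapHom.comp f.toHeapHom, fun t m => by
    change g (f (t • m)) = t • g (f m)
    simp⟩

@[simp] theorem comp_apply (g : LinHom T N K) (f : LinHom T M N) (a : M) : comp g f a = g (f a) := rfl

/-- Postcomposition as a morphism of heaps `Hom_T(M, N) → Hom_T(M, K)`. -/
def postcomp (g : LinHom T N K) : HeapHom (LinHom T M N) (LinHom T M K) :=
  ⟨fun f => g.comp f, fun a b c => ext fun m => by simp⟩

@[simp] theorem postcomp_apply (g : LinHom T N K) (f : LinHom T M N) : postcomp g f = g.comp f := rfl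

end LinHom

section Submodules

variable (T : Type u) {M : Type v} [Truss T] [AbHeap M] [TMod T M]

/-- Submodules: subsets (possibly empty) closed under the heap operation and the action. -/
structure IsSubmodule (S : Set M) : Prop where
  br_mem : ∀ a ∈ S, ∀ b ∈ S, ∀ c ∈ S, br a b c ∈ S
  smul_mem : ∀ (t : T), ∀ a ∈ S, t • a ∈ S

/-- A module is finitely generated if some finite subset is contained in no proper submodule. -/
def FinGen (M : Type v) [AbHeap M] [TMod T M] : Prop :=
  ∃ s : Finset M, ∀ S : Set M, IsSubmodule T S → (s : Set M) ⊆ S → S = Set.univ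

end Submodules

/-! ### The unital extension of a truss -/

section UnitalExtension

/-- The underlying heap `T ⊞ ⋆` of the unital extension of `T`. -/
abbrev UExt (T : Type u) [Truss T] : Type u := HeapSum T Unit

variable {T : Type u} [Truss T] {M : Type v} [AbHeap M]

/-- The canonical map `T → T ⊞ ⋆`. -/
def UExt.ι : HeapHom T (UExt T) := HeapSum.inl

/-- The element `*` of `T ⊞ ⋆`. -/
def UExt.star : UExt T := HeapSum.inr ()

theorem UExt.induction {p : UExt T → Prop} (hl : ∀ t, p (UExt.ι t)) (hs : p UExt.star)
    (hbr : ∀ a b c, p a → p b → p c → p (br a b c)) (z : UExt T) : p z :=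
  HeapSum.induction hl (fun _ => hs) hbr z

/-- The extension to `T ⊞ ⋆` of a map `ρ` from `T` to the endomorphisms of `M`, with `* ↦ id`. -/
def UExt.extend (ρ : HeapHom T (HeapHom M M)) : HeapHom (UExt T) (HeapHom M M) :=
  HeapSum.lift ρ (HeapHom.const Unit (HeapHom.id M))

@[simp] theorem UExt.extend_ι (ρ : HeapHom T (HeapHom M M)) (t : T) :
    UExt.extend ρ (UExt.ι t) = ρ t := rfl

@[simp] theorem UExt.extend_star (ρ : HeapHom T (HeapHom M M)) :
    UExt.extend ρ UExt.star = HeapHom.id M := rfl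

/-- Left multiplication by `t ∈ T` on `T ⊞ ⋆`: `t · t' = t t'` and `t · * = t`. -/
def UExt.lmul : HeapHom T (HeapHom (UExt T) (UExt T)) where
  toFun t := HeapSum.lift
    (UExt.ι.comp ⟨fun t' => t * t', Truss.mul_br t⟩) (HeapHom.const Unit (UExt.ι t))
  map_br' a b c := by
    refine HeapSum.hom_ext (fun m => ?_) (fun n => ?_)
    · simp [Truss.br_mul]
    · simp

@[simp] theorem UExt.lmul_ι (t t' : T) : UExt.lmul t (UExt.ι t') = UExt.ι (t * t') := rfl

@[simp] theorem UExt.lmul_star (t : T) : UExt.lmul t UExt.star = UExt.ι t := rfl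

/-- The multiplication of `T ⊞ ⋆`. -/
instance : Mul (UExt T) := ⟨fun z y => UExt.extend UExt.lmul z y⟩

theorem UExt.mul_def (z y : UExt T) : z * y = UExt.extend UExt.lmul z y := rfl

@[simp] theorem UExt.star_mul (z : UExt T) : UExt.star * z = z := rfl

@[simp] theorem UExt.ι_mul_star (t : T) : UExt.ι t * UExt.star = UExt.ι t := rfl

@[simp] theorem UExt.ι_mul_ι (s t : T) : UExt.ι s * UExt.ι t = UExt.ι (s * t) := rfl

theorem UExt.mul_br (z a b c : UExt T) : z * br a b c = br (z * a) (z * b) (z * c) := by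
  simp [UExt.mul_def]

theorem UExt.br_mul (z a b c : UExt T) : br a b c * z = br (a * z) (b * z) (c * z) := by
  simp [UExt.mul_def]

@[simp] theorem UExt.mul_star (z : UExt T) : z * UExt.star = z :=
  UExt.induction (p := fun z => z * UExt.star = z) (fun _ => rfl) rfl
    (fun a b c ha hb hc => by rw [UExt.br_mul, ha, hb, hc]) z

theorem UExt.mul_assoc (z y v : UExt T) : z * y * v = z * (y * v) := by
  induction z using UExt.induction with
  | hs => rfl
  | hbr a b c ha hb hc => simp only [UExt.br_mul, ha, hb, hc]
  | hl t =>
    induction y using UExt.induction with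
    | hs => rfl
    | hbr a b c ha hb hc => simp only [UExt.br_mul, UExt.mul_br, ha, hb, hc]
    | hl s =>
      induction v using UExt.induction with
      | hs => rfl
      | hbr a b c ha hb hc => simp only [UExt.mul_br, ha, hb, hc]
      | hl r => simp [_root_.mul_assoc]

/-- The unital extension of `T` is a truss (with identity `*`). -/
instance : Truss (UExt T) where
  mul_assoc := UExt.mul_assoc
  mul_br := UExt.mul_br
  br_mul := UExt.br_mul

/-- The unital extension as a left `T`-module, through `T → T ⊞ ⋆`. -/
instance : TMod T (UExt T) where
  smul t z := UExt.ι t * z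
  mul_smul s t z := by
    change UExt.ι (s * t) * z = UExt.ι s * (UExt.ι t * z)
    rw [← UExt.mul_assoc, UExt.ι_mul_ι]
  br_smul a b c z := by
    change UExt.ι (br a b c) * z = _
    rw [HeapHom.map_br, UExt.br_mul]; rfl
  smul_br t a b c := UExt.mul_br _ _ _ _

/-- The unital extension as a right `T`-module, through `T → T ⊞ ⋆`. -/
instance : TMod Tᵐᵒᵖ (UExt T) where
  smul t z := z * UExt.ι t.unop
  mul_smul s t z := by
    change z * UExt.ι (t.unop * s.unop) = z * UExt.ι t.unop * UExt.ι s.unop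
    rw [UExt.mul_assoc, UExt.ι_mul_ι]
  br_smul a b c z := by
    change z * UExt.ι (br a.unop b.unop c.unop) = _
    rw [HeapHom.map_br, UExt.mul_br]; rfl
  smul_br t a b c := UExt.br_mul _ _ _ _

theorem UExt.smul_def (t : T) (z : UExt T) : t • z = UExt.ι t * z := rfl

theorem UExt.op_smul_def (t : T) (z : UExt T) : op t • z = z * UExt.ι t := rfl

/-- The action of a truss on a module, as a map into the endomorphism truss. -/
def TMod.toEnd (T : Type u) (M : Type v) [Truss T] [AbHeap M] [TMod T M] :
    HeapHom T (HeapHom M M) where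
  toFun t := ⟨fun m => t • m, TMod.smul_br t⟩
  map_br' a b c := HeapHom.ext fun m => TMod.br_smul a b c m

/-- The unital action of the unital extension on a left `T`-module:
`t · m` is the given action and `* · m = m`. -/
def lact (T : Type u) (M : Type v) [Truss T] [AbHeap M] [TMod T M] :
    HeapHom (UExt T) (HeapHom M M) :=
  UExt.extend (TMod.toEnd T M)

/-- The unital action of the unital extension on a right `T`-module (the scalar comes first):
`m · t` is the given action and `m · * = m`. -/
def ract (T : Type u) (M : Type v) [Truss T] [AbHeap M] [TMod Tᵐᵒᵖ M] :
    HeapHom (UExt T) (HeapHom M M) :=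
  UExt.extend ((TMod.toEnd Tᵐᵒᵖ M).comp ⟨op, fun _ _ _ => rfl⟩)

@[simp] theorem lact_ι [TMod T M] (t : T) (m : M) : lact T M (UExt.ι t) m = t • m := rfl

@[simp] theorem lact_star [TMod T M] (m : M) : lact T M UExt.star m = m := rfl

@[simp] theorem ract_ι [TMod Tᵐᵒᵖ M] (t : T) (m : M) : ract T M (UExt.ι t) m = op t • m := rfl

@[simp] theorem ract_star [TMod Tᵐᵒᵖ M] (m : M) : ract T M UExt.star m = m := rfl

end UnitalExtension

/-! ### The dual module -/

/-- The dual `*P = Hom_T(P, T ⊞ ⋆)` of a left `T`-module `P`. -/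
abbrev Dual (T : Type u) (P : Type v) [Truss T] [AbHeap P] [TMod T P] : Type (max u v) :=
  LinHom T P (UExt T)

/-- The dual is a right `T`-module through `(f · t)(p) = f(p) t`. -/
instance {T : Type u} {P : Type v} [Truss T] [AbHeap P] [TMod T P] : TMod Tᵐᵒᵖ (Dual T P) where
  smul t f := ⟨⟨fun p => f p * UExt.ι t.unop, fun a b c => by
    rw [LinHom.map_br, UExt.br_mul]⟩, fun s p => by
    change f (s • p) * _ = UExt.ι s * (f p * _)
    rw [LinHom.map_smul, UExt.smul_def, UExt.mul_assoc]⟩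
  mul_smul s t f := LinHom.ext fun p => mul_smul s t (f p)
  br_smul a b c f := LinHom.ext fun p => TMod.br_smul a b c (f p)
  smul_br t f g h := LinHom.ext fun p => TMod.smul_br t (f p) (g p) (h p)

/-- The dual basis property: there are `e₀, …, e₂ₖ ∈ P` and `φ₀, …, φ₂ₖ ∈ *P` such that
`p = [φ₀(p) · e₀, …, φ₂ₖ(p) · e₂ₖ]` for all `p`. -/
def DualBasisProperty (T : Type u) (P : Type v) [Truss T] [AbHeap P] [TMod T P] : Prop :=
  ∃ (k : ℕ) (e : Fin (2 * k + 1) → P) (φ : Fin (2 * k + 1) → Dual T P),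
    ∀ p : P, p = oddBr k fun i => lact T P (φ i p) (e i)

/-! ### Tensor products -/

/-- Defining relations of tensor products: bilinearity, and identification of the simple tensors
related by `B`. -/
inductive TensorRel {M : Type u} {N : Type v} [AbHeap M] [AbHeap N] (B : M × N → M × N → Prop) :
    HeapWord (M × N) → HeapWord (M × N) → Prop
  | left (m m' m'' : M) (n : N) : TensorRel B (.of (br m m' m'', n))
      (.br (.of (m, n)) (.of (m', n)) (.of (m'', n)))
  | right (m : M) (n n' n'' : N) : TensorRel B (.of (m, br n n' n''))
      (.br (.of (m, n)) (.of (m, n')) (.of (m, n'')))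
  | bal {p q : M × N} : B p q → TensorRel B (.of p) (.of q)

/-- The abelian heap generated by simple tensors `m ⊗ n`, subject to bilinearity and `B`. -/
abbrev TensorBy {M : Type u} {N : Type v} [AbHeap M] [AbHeap N] (B : M × N → M × N → Prop) :
    Type (max u v) :=
  Presented (TensorRel B)

namespace TensorBy

variable {M : Type u} {N : Type v} {H : Type w} [AbHeap M] [AbHeap N] [AbHeap H]
  {B : M × N → M × N → Prop}

variable (B) in
/-- The universal bilinear map `(m, n) ↦ m ⊗ n`. -/
def tmul : HeapHom M (HeapHom N (TensorBy B)) where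
  toFun m := ⟨fun n => Presented.gen _ (m, n), fun a b c => Presented.mk_eq (TensorRel.right m a b c)⟩
  map_br' a b c := HeapHom.ext fun n => Presented.mk_eq (TensorRel.left a b c n)

theorem tmul_bal {m m' : M} {n n' : N} (h : B (m, n) (m', n')) : tmul B m n = tmul B m' n' :=
  Presented.mk_eq (TensorRel.bal h)

theorem induction {p : TensorBy B → Prop} (ht : ∀ m n, p (tmul B m n))
    (hbr : ∀ a b c, p a → p b → p c → p (br a b c)) (z : TensorBy B) : p z :=
  Presented.induction (fun a => ht a.1 a.2) hbr z

/-- The universal property of the tensor product. -/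
def lift (f : HeapHom M (HeapHom N H)) (hf : ∀ p q, B p q → f p.1 p.2 = f q.1 q.2) :
    HeapHom (TensorBy B) H :=
  Presented.lift (fun p => f p.1 p.2) (by
    rintro _ _ (⟨a, b, c, n⟩ | ⟨m, a, b, c⟩ | h)
    · change f (br a b c) n = br (f a n) (f b n) (f c n)
      simp
    · exact (f m).map_br a b c
    · exact hf _ _ h)

@[simp] theorem lift_tmul (f : HeapHom M (HeapHom N H)) (hf) (m : M) (n : N) :
    lift (B := B) f hf (tmul B m n) = f m n := rfl

theorem hom_ext {f g : HeapHom (TensorBy B) H} (h : ∀ m n, f (tmul B m n) = g (tmul B m n)) :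
    f = g :=
  Presented.hom_ext fun a => h a.1 a.2

end TensorBy

/-- The tensor product `M ⊗ N` of abelian heaps (that is, over `⋆`). -/
abbrev HTensor (M : Type u) (N : Type v) [AbHeap M] [AbHeap N] : Type (max u v) :=
  TensorBy fun _ _ : M × N => False

/-- The balancing relation `(m · t) ⊗ n = m ⊗ (t · n)`. -/
def Balanced (T : Type u) (M : Type v) (N : Type w) [Truss T] [AbHeap M] [AbHeap N]
    [TMod Tᵐᵒᵖ M] [TMod T N] (p q : M × N) : Prop :=
  ∃ (m : M) (t : T) (n : N), p = (op t • m, n) ∧ q = (m, t • n)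

/-- The tensor product `M ⊗_T N` of a right `T`-module and a left `T`-module. -/
abbrev Tensor (T : Type u) (M : Type v) (N : Type w) [Truss T] [AbHeap M] [AbHeap N]
    [TMod Tᵐᵒᵖ M] [TMod T N] : Type (max v w) :=
  TensorBy (Balanced T M N)

section HTensor

variable {M : Type u} {N : Type v} {M' : Type w} {N' : Type x}
  [AbHeap M] [AbHeap N] [AbHeap M'] [AbHeap N']

/-- The simple tensor `m ⊗ n`, as a bilinear map. -/
abbrev htmul (M : Type u) (N : Type v) [AbHeap M] [AbHeap N] :
    HeapHom M (HeapHom N (HTensor M N)) :=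
  TensorBy.tmul _

/-- The morphism `f ⊗ g`. -/
def HTensor.map (f : HeapHom M M') (g : HeapHom N N') : HeapHom (HTensor M N) (HTensor M' N') :=
  TensorBy.lift ⟨fun m => (htmul M' N' (f m)).comp g, fun a b c => by ext; simp⟩
    (fun _ _ h => h.elim)

@[simp] theorem HTensor.map_tmul (f : HeapHom M M') (g : HeapHom N N') (m : M) (n : N) :
    HTensor.map f g (TensorBy.tmul _ m n) = TensorBy.tmul _ (f m) (g n) := rfl

variable {T : Type y} [Truss T]

/-- If `M` is a left `T`-module, so is `M ⊗ N`: `t · (m ⊗ n) = (t · m) ⊗ n`. -/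
instance HTensor.leftMod [TMod T M] : TMod T (HTensor M N) where
  smul t := HTensor.map (TMod.toEnd T M t) (HeapHom.id N)
  mul_smul s t z := TensorBy.induction
    (p := fun z => HTensor.map (TMod.toEnd T M (s * t)) (HeapHom.id N) z =
      HTensor.map (TMod.toEnd T M s) (HeapHom.id N) (HTensor.map (TMod.toEnd T M t) (HeapHom.id N) z))
    (fun m n => congrArg (fun m' => htmul M N m' n) (mul_smul s t m))
    (fun a b c ha hb hc => by simp only [HeapHom.map_br, ha, hb, hc]) z
  br_smul a b c z := by
    have h : HTensor.map (TMod.toEnd T M (br a b c)) (HeapHom.id N) =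
        br (HTensor.map (TMod.toEnd T M a) (HeapHom.id N))
          (HTensor.map (TMod.toEnd T M b) (HeapHom.id N))
          (HTensor.map (TMod.toEnd T M c) (HeapHom.id N)) :=
      TensorBy.hom_ext fun m n => by simp
    exact DFunLike.congr_fun h z
  smul_br t := (HTensor.map (TMod.toEnd T M t) (HeapHom.id N)).map_br

/-- If `N` is a right `T`-module, so is `M ⊗ N`: `(m ⊗ n) · t = m ⊗ (n · t)`. -/
instance HTensor.rightMod [TMod Tᵐᵒᵖ N] : TMod Tᵐᵒᵖ (HTensor M N) where
  smul t := HTensor.map (HeapHom.id M) (TMod.toEnd Tᵐᵒᵖ N t)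
  mul_smul s t z := TensorBy.induction
    (p := fun z => HTensor.map (HeapHom.id M) (TMod.toEnd Tᵐᵒᵖ N (s * t)) z =
      HTensor.map (HeapHom.id M) (TMod.toEnd Tᵐᵒᵖ N s)
        (HTensor.map (HeapHom.id M) (TMod.toEnd Tᵐᵒᵖ N t) z))
    (fun m n => congrArg (fun n' => htmul M N m n') (mul_smul s t n))
    (fun a b c ha hb hc => by simp only [HeapHom.map_br, ha, hb, hc]) z
  br_smul a b c z := by
    have h : HTensor.map (HeapHom.id M) (TMod.toEnd Tᵐᵒᵖ N (br a b c)) =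
        br (HTensor.map (HeapHom.id M) (TMod.toEnd Tᵐᵒᵖ N a))
          (HTensor.map (HeapHom.id M) (TMod.toEnd Tᵐᵒᵖ N b))
          (HTensor.map (HeapHom.id M) (TMod.toEnd Tᵐᵒᵖ N c)) :=
      TensorBy.hom_ext fun m n => by simp
    exact DFunLike.congr_fun h z
  smul_br t := (HTensor.map (HeapHom.id M) (TMod.toEnd Tᵐᵒᵖ N t)).map_br

theorem HTensor.smul_tmul [TMod T M] (t : T) (m : M) (n : N) :
    t • htmul M N m n = htmul M N (t • m) n := rfl

theorem HTensor.op_smul_tmul [TMod Tᵐᵒᵖ N] (t : T) (m : M) (n : N) :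
    op t • htmul M N m n = htmul M N m (op t • n) := rfl

end HTensor

section Tensor

variable {T : Type u} [Truss T] {M : Type v} {M' : Type w} {N : Type x}
  {N' : Type y} {H : Type z}
  [AbHeap M] [AbHeap M'] [AbHeap N] [AbHeap N'] [AbHeap H]
  [TMod Tᵐᵒᵖ M] [TMod Tᵐᵒᵖ M'] [TMod T N] [TMod T N']

/-- The simple tensor `m ⊗_T n`, as a bilinear map. -/
abbrev tmul (T : Type u) (M : Type v) (N : Type w) [Truss T] [AbHeap M] [AbHeap N]
    [TMod Tᵐᵒᵖ M] [TMod T N] : HeapHom M (HeapHom N (Tensor T M N)) :=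
  TensorBy.tmul _

theorem tmul_balanced (m : M) (t : T) (n : N) :
    tmul T M N (op t • m) n = tmul T M N m (t • n) :=
  TensorBy.tmul_bal ⟨m, t, n, rfl, rfl⟩

/-- The universal property of the tensor product over `T`. -/
def Tensor.lift (f : HeapHom M (HeapHom N H))
    (hf : ∀ (m : M) (t : T) (n : N), f (op t • m) n = f m (t • n)) : HeapHom (Tensor T M N) H :=
  TensorBy.lift f (by rintro _ _ ⟨m, t, n, rfl, rfl⟩; exact hf m t n)

@[simp] theorem Tensor.lift_tmul (f : HeapHom M (HeapHom N H)) (hf) (m : M) (n : N) :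
    Tensor.lift (T := T) f hf (TensorBy.tmul _ m n) = f m n := rfl

/-- The morphism `f ⊗_T g`. -/
def Tensor.map (f : LinHom Tᵐᵒᵖ M M') (g : LinHom T N N') :
    HeapHom (Tensor T M N) (Tensor T M' N') :=
  Tensor.lift ⟨fun m => (tmul T M' N' (f m)).comp g.toHeapHom, fun a b c => by ext; simp⟩
    (fun m t n => by simpa using tmul_balanced (f m) t (g n))

@[simp] theorem Tensor.map_tmul (f : LinHom Tᵐᵒᵖ M M') (g : LinHom T N N') (m : M) (n : N) :
    Tensor.map f g (TensorBy.tmul _ m n) = TensorBy.tmul _ (f m) (g n) := rfl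

end Tensor

/-! ### Canonical morphisms -/

section Canonical

variable {T : Type u} [Truss T] {A : Type v} {M : Type w} {N : Type x}
  [AbHeap A] [AbHeap M] [AbHeap N]

/-- The associativity isomorphism `A ⊗ (M ⊗_T N) → (A ⊗ M) ⊗_T N`,
`a ⊗ (m ⊗ n) ↦ (a ⊗ m) ⊗ n`. -/
def assocLeft [TMod Tᵐᵒᵖ M] [TMod T N] :
    HeapHom (HTensor A (Tensor T M N)) (Tensor T (HTensor A M) N) :=
  TensorBy.lift
    ⟨fun a => Tensor.lift ((tmul T (HTensor A M) N).comp (htmul A M a))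
        (fun m t n => tmul_balanced (htmul A M a m) t n),
      fun a b c => TensorBy.hom_ext fun m n => by simp; rfl⟩
    (fun _ _ h => h.elim)

/-- The associativity isomorphism `(M ⊗_T N) ⊗ A → M ⊗_T (N ⊗ A)`,
`(m ⊗ n) ⊗ a ↦ m ⊗ (n ⊗ a)`. -/
def assocRight [TMod Tᵐᵒᵖ M] [TMod T N] :
    HeapHom (HTensor (Tensor T M N) A) (Tensor T M (HTensor N A)) :=
  TensorBy.lift
    (Tensor.lift
      ⟨fun m => ⟨fun n => (tmul T M (HTensor N A) m).comp (htmul N A n),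
          fun a b c => by ext; simp⟩,
        fun a b c => by ext; simp⟩
      (fun m t n => HeapHom.ext fun a => tmul_balanced m t (htmul N A n a)))
    (fun _ _ h => h.elim)

@[simp] theorem assocLeft_tmul [TMod Tᵐᵒᵖ M] [TMod T N] (a : A) (m : M) (n : N) :
    assocLeft (T := T) (TensorBy.tmul _ a (TensorBy.tmul _ m n)) =
      TensorBy.tmul _ (TensorBy.tmul _ a m) n := rfl

@[simp] theorem assocRight_tmul [TMod Tᵐᵒᵖ M] [TMod T N] (a : A) (m : M) (n : N) :
    assocRight (T := T) (TensorBy.tmul _ (TensorBy.tmul _ m n) a) =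
      TensorBy.tmul _ m (TensorBy.tmul _ n a) := rfl

/-- The canonical isomorphism `M → M ⊗ ⋆`, `m ↦ m ⊗ *`. -/
def rightUnit : HeapHom M (HTensor M Unit) :=
  ⟨fun m => htmul M Unit m (), fun a b c => by simp⟩

/-- The canonical isomorphism `M → ⋆ ⊗ M`, `m ↦ * ⊗ m`. -/
def leftUnit : HeapHom M (HTensor Unit M) := htmul Unit M ()

/-- The canonical isomorphism `(T ⊞ ⋆) ⊗_T N → N`, `z ⊗ n ↦ z · n`. -/
def leftAct [TMod T N] : HeapHom (Tensor T (UExt T) N) N :=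
  Tensor.lift (lact T N) (fun z t n => by
    rw [UExt.op_smul_def]
    induction z using UExt.induction with
    | hs => rfl
    | hl s => exact mul_smul s t n
    | hbr a b c ha hb hc => simp only [UExt.br_mul, HeapHom.map_br, HeapHom.br_apply, ha, hb, hc])

/-- The canonical isomorphism `M ⊗_T (T ⊞ ⋆) → M`, `m ⊗ z ↦ m · z`. -/
def rightAct [TMod Tᵐᵒᵖ M] : HeapHom (Tensor T M (UExt T)) M :=
  Tensor.lift
    ⟨fun m => ⟨fun z => ract T M z m, fun a b c => by simp⟩, fun a b c => by ext; simp⟩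
    (fun m t z => by
      rw [UExt.smul_def]
      change ract T M z (op t • m) = ract T M (UExt.ι t * z) m
      induction z using UExt.induction with
      | hs => rfl
      | hl s => exact (mul_smul (op s) (op t) m).symm
      | hbr a b c ha hb hc => simp only [UExt.mul_br, HeapHom.map_br, HeapHom.br_apply, ha, hb, hc])

end Canonical

/-! ### Evaluation and dual basis maps -/

/-- `T`-bilinear morphisms: morphisms of heaps that are linear over `T` on both sides. -/
structure BilinHom (T : Type u) (M : Type v) (N : Type w) [Truss T] [AbHeap M] [AbHeap N]
    [TMod T M] [TMod Tᵐᵒᵖ M] [TMod T N] [TMod Tᵐᵒᵖ N] extends HeapHom M N where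
  map_smul' : ∀ (t : T) (m : M), toFun (t • m) = t • toFun m
  map_op_smul' : ∀ (t : T) (m : M), toFun (op t • m) = op t • toFun m

/-- The underlying morphism of left modules. -/
def BilinHom.toLeft {T : Type u} {M : Type v} {N : Type w} [Truss T] [AbHeap M] [AbHeap N]
    [TMod T M] [TMod Tᵐᵒᵖ M] [TMod T N] [TMod Tᵐᵒᵖ N] (f : BilinHom T M N) : LinHom T M N :=
  ⟨f.toHeapHom, f.map_smul'⟩

/-- The underlying morphism of right modules. -/
def BilinHom.toRight {T : Type u} {M : Type v} {N : Type w} [Truss T] [AbHeap M] [AbHeap N]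
    [TMod T M] [TMod Tᵐᵒᵖ M] [TMod T N] [TMod Tᵐᵒᵖ N] (f : BilinHom T M N) : LinHom Tᵐᵒᵖ M N :=
  ⟨f.toHeapHom, fun t m => f.map_op_smul' t.unop m⟩

section Zigzag

variable {T : Type u} {P : Type v} [Truss T] [AbHeap P] [TMod T P]

/-- The composite
`P ≅ P ⊗ ⋆ → P ⊗ (*P ⊗_T P) ≅ (P ⊗ *P) ⊗_T P → (T ⊞ ⋆) ⊗_T P ≅ P`
of `P ⊗ db` and `ev ⊗_T P`. -/
def zigzagLeft (ev : BilinHom T (HTensor P (Dual T P)) (UExt T))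
    (db : HeapHom Unit (Tensor T (Dual T P) P)) : HeapHom P P :=
  leftAct.comp ((Tensor.map ev.toRight (LinHom.id T P)).comp
    (assocLeft.comp ((HTensor.map (HeapHom.id P) db).comp rightUnit)))

/-- The composite
`*P ≅ ⋆ ⊗ *P → (*P ⊗_T P) ⊗ *P ≅ *P ⊗_T (P ⊗ *P) → *P ⊗_T (T ⊞ ⋆) ≅ *P`
of `db ⊗ *P` and `*P ⊗_T ev`. -/
def zigzagRight (ev : BilinHom T (HTensor P (Dual T P)) (UExt T))
    (db : HeapHom Unit (Tensor T (Dual T P) P)) : HeapHom (Dual T P) (Dual T P) :=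
  rightAct.comp ((Tensor.map (LinHom.id Tᵐᵒᵖ (Dual T P)) ev.toLeft).comp
    (assocRight.comp ((HTensor.map db (HeapHom.id (Dual T P))).comp leftUnit)))

end Zigzag

/-! ### The categories and the functors -/

open CategoryTheory

/-- The category `Ah` of abelian heaps. -/
structure Ah : Type (u + 1) where
  carrier : Type u
  [str : AbHeap carrier]

attribute [instance] Ah.str

instance : CoeSort Ah.{u} (Type u) := ⟨Ah.carrier⟩

instance : Category Ah.{u} where
  Hom A B := HeapHom A B
  id A := HeapHom.id A
  comp f g := g.comp f

/-- The category of left `T`-modules. -/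
structure ModCat (T : Type u) [Truss T] : Type (u + 1) where
  carrier : Type u
  [heap : AbHeap carrier]
  [tmod : TMod T carrier]

attribute [instance] ModCat.heap ModCat.tmod

section Functors

variable (T : Type u) [Truss T]

instance : CoeSort (ModCat T) (Type u) := ⟨ModCat.carrier⟩

instance : Category (ModCat T) where
  Hom M N := LinHom T M N
  id M := LinHom.id T M
  comp f g := g.comp f

/-- The functor `Hom_T(P, -)` from left `T`-modules to abelian heaps. -/
def homFunctor (P : Type u) [AbHeap P] [TMod T P] : ModCat T ⥤ Ah.{u} where
  obj M := ⟨LinHom T P M⟩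
  map {M N} (f : LinHom T M N) := (LinHom.postcomp f : HeapHom (LinHom T P M) (LinHom T P N))

/-- The functor `Q ⊗_T -` from left `T`-modules to abelian heaps, for a right `T`-module `Q`. -/
def tensorFunctor (Q : Type u) [AbHeap Q] [TMod Tᵐᵒᵖ Q] : ModCat T ⥤ Ah.{u} where
  obj M := ⟨Tensor T Q M⟩
  map {M N} (f : LinHom T M N) := Tensor.map (LinHom.id Tᵐᵒᵖ Q) f
  map_id M := TensorBy.hom_ext (B := Balanced T Q M) fun _ _ => rfl
  map_comp {M _ _} _ _ := TensorBy.hom_ext (B := Balanced T Q M) fun _ _ => rfl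

end Functors

end Trusses

/-! A dual basis is a finite amount of data that splits `P` off a free module, and every condition
either produces or consumes it. Write T̄ for the unital extension.

To obtain one from colimit preservation, pick generators `e : X → P` and the surjection π from the
free module, a coproduct of copies of T̄ indexed by `X`. As a surjection, π is the coequalizer of
its kernel pair. A colimit of abelian heaps is generated under brackets by the images of its
components (`Ah.isColimit_induction`), and this is used twice. On the preserved coequalizer it shows
that every map into `P` lifts along π, so the identity lifts to a section s
(`exists_comp_eq_of_surjective`). On the preserved coproduct it shows that s is an odd bracket of
functionals P → T̄ followed by summand inclusions (`exists_oddBr_of_homFreeMod`). Applying π to s(p)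
gives the dual basis formula. Right exactness allows only finite `X`, whence finite generation; a
cocontinuous functor allows `X = P`.

Conversely, expanding p and applying a linear f expresses f through its values f(e_i). For f in the
dual this is a dual basis of the right module *P; both triangle identities are these two expansions.
The same expansions make f ↦ [φ_i ⊗ f(e_i)] inverse to the canonical map from *P ⊗_T N to Hom_T(P,
N). Tensoring is left adjoint to Hom(*P, -), hence cocontinuous. In the other direction, writing
db(*) as a bracket of simple tensors turns the first triangle into the dual basis formula. -/

namespace Trusses

open MulOpposite AbHeap CategoryTheory CategoryTheory.Limits

/-! ### Brackets of odd length -/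

section OddBrackets

variable {H : Type u} {K : Type v} [AbHeap H] [AbHeap K]

theorem HeapHom.map_oddBr (f : HeapHom H K) :
    ∀ (k : ℕ) (a : Fin (2 * k + 1) → H), f (oddBr k a) = oddBr k fun i => f (a i)
  | 0, _ => rfl
  | k + 1, a => by simp [oddBr, HeapHom.map_oddBr f k]

theorem oddBr_mem {S : H → Prop} (hS : ∀ a b c, S a → S b → S c → S (br a b c)) :
    ∀ (k : ℕ) (a : Fin (2 * k + 1) → H), (∀ i, S (a i)) → S (oddBr k a)
  | 0, _, h => h 0
  | k + 1, _, h => hS _ _ _ (oddBr_mem hS k _ fun _ => h _) (h _) (h _)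

/-- Left-normed brackets of odd length with letters in the range of `f`. -/
inductive OddWord {X : Type w} (f : X → H) : H → Prop
  | of (x : X) : OddWord f (f x)
  | br {z : H} (x y : X) : OddWord f z → OddWord f (br z (f x) (f y))

namespace OddWord

variable {X : Type w} {f : X → H}

/-- Associativity peels letters off `c`. Once `c` is a letter, `br_mid` moves letters of `b` over to
`a` in reversed order, so `a` must vary in the inner induction. -/
theorem br_mem {a b c : H} (ha : OddWord f a) (hb : OddWord f b) (hc : OddWord f c) :
    OddWord f (AbHeap.br a b c) := by
  induction hc with
  | br x y _ ih => rw [← br_assoc]; exact .br x y ih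
  | of x =>
    induction hb generalizing a with
    | of y => exact .br y x ha
    | br s t _ ih => rw [br_mid]; exact ih (.br t s ha)

theorem exists_oddBr {z : H} (h : OddWord f z) :
    ∃ (k : ℕ) (a : Fin (2 * k + 1) → X), z = oddBr k fun i => f (a i) := by
  induction h with
  | of x => exact ⟨0, fun _ => x, rfl⟩
  | br x y _ ih =>
    obtain ⟨k, a, rfl⟩ := ih
    refine ⟨k + 1, fun i => if h : i.1 < 2 * k + 1 then a ⟨i.1, h⟩ else
      if i.1 = 2 * k + 1 then x else y, ?_⟩
    have hi (i : Fin (2 * k + 1)) : i.1 ≤ 2 * k := Nat.lt_succ_iff.mp i.2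
    simp [oddBr, hi]

end OddWord

end OddBrackets

/-- Simple tensors generate under brackets, and nested brackets can be made left-normed. This
extracts finite data from db(*). -/
theorem TensorBy.exists_oddBr {M : Type u} {N : Type v} [AbHeap M] [AbHeap N]
    {B : M × N → M × N → Prop} (z : TensorBy B) :
    ∃ (k : ℕ) (m : Fin (2 * k + 1) → M) (n : Fin (2 * k + 1) → N),
      z = oddBr k fun i => tmul B (m i) (n i) := by
  have h : OddWord (fun p : M × N => tmul B p.1 p.2) z :=
    TensorBy.induction (fun m n => OddWord.of (f := fun p : M × N => tmul B p.1 p.2) (m, n))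
      (fun _ _ _ => OddWord.br_mem) z
  obtain ⟨k, a, h⟩ := h.exists_oddBr
  exact ⟨k, fun i => (a i).1, fun i => (a i).2, h⟩

/-! ### Linearity over the unital extension -/

section UnitalAction

variable {T : Type u} [Truss T]

/-- Both sides respect brackets in `z`, so it suffices to check `z` in `T` and `z = *`. The other
compatibilities of the extended actions below follow the same pattern. -/
theorem lact_smul {M : Type v} [AbHeap M] [TMod T M] (t : T) (z : UExt T) (m : M) :
    lact T M (t • z) m = t • lact T M z m := by
  rw [UExt.smul_def]
  induction z using UExt.induction with
  | hs => rfl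
  | hl s => exact mul_smul t s m
  | hbr a b c ha hb hc =>
    simp only [UExt.mul_br, HeapHom.map_br, HeapHom.br_apply, ha, hb, hc, TMod.smul_br]

theorem LinHom.map_lact {M : Type v} {N : Type w} [AbHeap M] [AbHeap N] [TMod T M] [TMod T N]
    (f : LinHom T M N) (z : UExt T) (m : M) : f (lact T M z m) = lact T N z (f m) := by
  induction z using UExt.induction with
  | hs => rfl
  | hl s => exact f.map_smul s m
  | hbr a b c ha hb hc => simp only [HeapHom.map_br, HeapHom.br_apply, LinHom.map_br, ha, hb, hc]

theorem lact_eq_mul (z y : UExt T) : lact T (UExt T) z y = z * y := by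
  induction z using UExt.induction with
  | hs => rfl
  | hl s => rfl
  | hbr a b c ha hb hc => simp only [HeapHom.map_br, HeapHom.br_apply, UExt.br_mul, ha, hb, hc]

theorem ract_dual_apply {P : Type v} [AbHeap P] [TMod T P] (z : UExt T) (f : Dual T P) (p : P) :
    ract T (Dual T P) z f p = f p * z := by
  induction z using UExt.induction with
  | hs => exact (UExt.mul_star _).symm
  | hl s => rfl
  | hbr a b c ha hb hc =>
    simp only [HeapHom.map_br, HeapHom.br_apply, LinHom.br_apply, UExt.mul_br, ha, hb, hc]

/-- Coefficients such as f(e_i) lie in the unital extension, so balancing over `T` alone would not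
let them cross the tensor sign. -/
theorem tmul_ract {M : Type v} {N : Type w} [AbHeap M] [AbHeap N] [TMod Tᵐᵒᵖ M] [TMod T N]
    (m : M) (z : UExt T) (n : N) :
    tmul T M N (ract T M z m) n = tmul T M N m (lact T N z n) := by
  induction z using UExt.induction with
  | hs => rfl
  | hl s => exact tmul_balanced m s n
  | hbr a b c ha hb hc => simp only [HeapHom.map_br, HeapHom.br_apply, ha, hb, hc]

/-- The morphism `T ⊞ ⋆ → N` sending `*` to `n`. -/
def lactHom (T : Type u) {N : Type v} [Truss T] [AbHeap N] [TMod T N] (n : N) :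
    LinHom T (UExt T) N :=
  ⟨⟨fun z => lact T N z n, fun a b c => by simp⟩, fun t z => lact_smul t z n⟩

end UnitalAction

/-! ### Dual bases, evaluation and coevaluation -/

section DualBasis

variable {T : Type u} {P : Type v} [Truss T] [AbHeap P] [TMod T P]

/-- Evaluation of linear maps at a point. -/
def LinHom.evalAt {N : Type w} [AbHeap N] [TMod T N] (p : P) : HeapHom (LinHom T P N) N :=
  ⟨fun f => f p, fun _ _ _ => rfl⟩

theorem LinHom.oddBr_apply {N : Type w} [AbHeap N] [TMod T N] (k : ℕ)
    (f : Fin (2 * k + 1) → LinHom T P N) (p : P) : oddBr k f p = oddBr k fun i => f i p :=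
  (LinHom.evalAt p).map_oddBr k f

section

variable {k : ℕ} {e : Fin (2 * k + 1) → P} {φ : Fin (2 * k + 1) → Dual T P}

theorem eq_oddBr_lact_of_dualBasis (h : ∀ p : P, p = oddBr k fun i => lact T P (φ i p) (e i))
    {N : Type w} [AbHeap N] [TMod T N] (f : LinHom T P N) (p : P) :
    f p = oddBr k fun i => lact T N (φ i p) (f (e i)) := by
  conv_lhs => rw [h p, ← LinHom.toHeapHom_apply, HeapHom.map_oddBr]
  simp only [LinHom.toHeapHom_apply, LinHom.map_lact]

/-- The expansion of a linear map with target the unital extension, where acting is multiplying: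
φ_i(p) f(e_i) is the value at p of φ_i · f(e_i). Thus the φ_i generate the dual. -/
theorem eq_oddBr_ract_of_dualBasis (h : ∀ p : P, p = oddBr k fun i => lact T P (φ i p) (e i))
    (f : Dual T P) : f = oddBr k fun i => ract T (Dual T P) (f (e i)) (φ i) := by
  ext p
  rw [LinHom.oddBr_apply, eq_oddBr_lact_of_dualBasis h f p]
  simp only [ract_dual_apply, lact_eq_mul]

end

theorem DualBasisProperty.finGen (h : DualBasisProperty T P) : FinGen T P := by
  classical
  obtain ⟨k, e, φ, h⟩ := h
  refine ⟨Finset.univ.image e, fun S hS hs => Set.eq_univ_of_forall fun p => ?_⟩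
  rw [h p]
  refine oddBr_mem (S := (· ∈ S)) (fun a b c ha hb hc => hS.br_mem a ha b hb c hc) k _ fun i => ?_
  have he : e i ∈ S := hs (by simp)
  -- The scalar φ_i(p) is a bracket of elements of `T` and copies of `*`, and `*` fixes e_i; hence
  -- φ_i(p) · e_i stays in `S`.
  induction φ i p using UExt.induction with
  | hs => exact he
  | hl t => exact hS.smul_mem t _ he
  | hbr a b c ha hb hc =>
    simp only [HeapHom.map_br, HeapHom.br_apply]
    exact hS.br_mem _ ha _ hb _ hc

/-- The evaluation map `P ⊗ *P → T ⊞ ⋆`. -/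
def evalDual (T : Type u) (P : Type v) [Truss T] [AbHeap P] [TMod T P] :
    BilinHom T (HTensor P (Dual T P)) (UExt T) where
  toHeapHom := TensorBy.lift ⟨LinHom.evalAt, fun a b c => HeapHom.ext fun f => f.map_br a b c⟩
    fun _ _ h => h.elim
  map_smul' t z := by
    induction z using TensorBy.induction with
    | ht p f => exact f.map_smul t p
    | hbr a b c ha hb hc =>
      change TensorBy.lift _ _ _ = t • TensorBy.lift _ _ _ at ha hb hc
      change TensorBy.lift _ _ _ = t • TensorBy.lift _ _ _
      simp only [TMod.smul_br, HeapHom.map_br, ha, hb, hc]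
  map_op_smul' t z := by
    induction z using TensorBy.induction with
    | ht p f => rfl
    | hbr a b c ha hb hc =>
      change TensorBy.lift _ _ _ = op t • TensorBy.lift _ _ _ at ha hb hc
      change TensorBy.lift _ _ _ = op t • TensorBy.lift _ _ _
      simp only [TMod.smul_br, HeapHom.map_br, ha, hb, hc]

/-- With p fixed, the composite is a heap morphism evaluated at db(*), hence determined by simple
tensors. Here `ev` is arbitrary, as needed for recovering a dual basis. -/
theorem zigzagLeft_apply (ev : BilinHom T (HTensor P (Dual T P)) (UExt T))
    {db : HeapHom Unit (Tensor T (Dual T P) P)} {k : ℕ} {φ : Fin (2 * k + 1) → Dual T P}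
    {e : Fin (2 * k + 1) → P} (h : db () = oddBr k fun i => tmul T (Dual T P) P (φ i) (e i))
    (p : P) : zigzagLeft ev db p =
      oddBr k fun i => lact T P (ev.toHeapHom (htmul P (Dual T P) p (φ i))) (e i) := by
  change (leftAct.comp ((Tensor.map ev.toRight (LinHom.id T P)).comp
    (assocLeft.comp (htmul P (Tensor T (Dual T P) P) p)))) (db ()) = _
  rw [h, HeapHom.map_oddBr]
  rfl

theorem zigzagRight_apply (ev : BilinHom T (HTensor P (Dual T P)) (UExt T))
    {db : HeapHom Unit (Tensor T (Dual T P) P)} {k : ℕ} {φ : Fin (2 * k + 1) → Dual T P}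
    {e : Fin (2 * k + 1) → P} (h : db () = oddBr k fun i => tmul T (Dual T P) P (φ i) (e i))
    (f : Dual T P) : zigzagRight ev db f =
      oddBr k fun i => ract T (Dual T P) (ev.toHeapHom (htmul P (Dual T P) (e i) f)) (φ i) := by
  -- The morphism z ↦ z ⊗ f, so that db(*) becomes the variable.
  let g : HeapHom (Tensor T (Dual T P) P) (HTensor (Tensor T (Dual T P) P) (Dual T P)) :=
    ⟨fun z => htmul _ (Dual T P) z f, fun a b c => by simp⟩
  change (rightAct.comp ((Tensor.map (LinHom.id Tᵐᵒᵖ (Dual T P)) ev.toLeft).comp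
    (assocRight.comp g))) (db ()) = _
  rw [h, HeapHom.map_oddBr]
  rfl

theorem DualBasisProperty.exists_zigzag (h : DualBasisProperty T P) :
    ∃ (ev : BilinHom T (HTensor P (Dual T P)) (UExt T))
      (db : HeapHom Unit (Tensor T (Dual T P) P)),
      zigzagLeft ev db = HeapHom.id P ∧ zigzagRight ev db = HeapHom.id (Dual T P) := by
  obtain ⟨k, e, φ, h⟩ := h
  refine ⟨evalDual T P, HeapHom.const Unit (oddBr k fun i => tmul T (Dual T P) P (φ i) (e i)),
    HeapHom.ext fun p => ?_, HeapHom.ext fun f => ?_⟩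
  · rw [zigzagLeft_apply _ rfl]
    exact (h p).symm
  · rw [zigzagRight_apply _ rfl]
    exact (eq_oddBr_ract_of_dualBasis h f).symm

/-- If db(*) = [φ_i ⊗ e_i], the functionals of the dual basis are p ↦ ev(p ⊗ φ_i) rather than φ_i,
since `ev` need not be evaluation. They are linear because `ev` is left linear. -/
theorem DualBasisProperty.of_zigzagLeft (ev : BilinHom T (HTensor P (Dual T P)) (UExt T))
    (db : HeapHom Unit (Tensor T (Dual T P) P)) (h : zigzagLeft ev db = HeapHom.id P) :
    DualBasisProperty T P := by
  obtain ⟨k, φ, e, hdb⟩ := TensorBy.exists_oddBr (db ())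
  refine ⟨k, e, fun i => ⟨⟨fun p => ev.toHeapHom (htmul P (Dual T P) p (φ i)),
    fun a b c => by simp⟩, fun t p => ev.map_smul' t (htmul P (Dual T P) p (φ i))⟩, fun p => ?_⟩
  have hp := zigzagLeft_apply ev hdb p
  rw [h] at hp
  exact hp

end DualBasis

/-! ### Representing the functor `Hom_T(P, -)` by the dual -/

section Representation

variable {T : Type u} [Truss T]

/-- The canonical morphism `*P ⊗_T N → Hom_T(P, N)`, `φ ⊗ n ↦ (p ↦ φ(p) · n)`. -/
def dualTensorHom (T : Type u) [Truss T] (P : Type v) (N : Type w) [AbHeap P] [TMod T P]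
    [AbHeap N] [TMod T N] : HeapHom (Tensor T (Dual T P) N) (LinHom T P N) :=
  Tensor.lift
    ⟨fun φ => ⟨fun n => (lactHom T n).comp φ, fun a b c => LinHom.ext fun p =>
        HeapHom.map_br (lact T N (φ p)) a b c⟩,
      fun a b c => HeapHom.ext fun n => LinHom.ext fun p => (lactHom T n).map_br _ _ _⟩
    (fun φ t n => LinHom.ext fun p => by
      change lact T N (φ p * UExt.ι t) n = lact T N (φ p) (t • n)
      -- Balancing is the linearity of z ↦ z · n over the unital extension.
      rw [← lact_ι, ← lact_eq_mul]
      exact (lactHom T n).map_lact (φ p) (UExt.ι t))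

/-- The morphism `Hom_T(P, N) → *P ⊗_T N`, `f ↦ [φ₀ ⊗ f(e₀), …, φ₂ₖ ⊗ f(e₂ₖ)]`. -/
def homDualTensor {P : Type v} [AbHeap P] [TMod T P] (N : Type w) [AbHeap N] [TMod T N] :
    (k : ℕ) → (Fin (2 * k + 1) → P) → (Fin (2 * k + 1) → Dual T P) →
      HeapHom (LinHom T P N) (Tensor T (Dual T P) N) :=
  fun k e φ => oddBr k fun i => (tmul T (Dual T P) N (φ i)).comp (LinHom.evalAt (e i))

theorem homDualTensor_apply {P : Type v} [AbHeap P] [TMod T P] (N : Type w) [AbHeap N] [TMod T N]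
    (k : ℕ) (e : Fin (2 * k + 1) → P) (φ : Fin (2 * k + 1) → Dual T P) (f : LinHom T P N) :
    homDualTensor N k e φ f = oddBr k fun i => tmul T (Dual T P) N (φ i) (f (e i)) :=
  HeapHom.map_oddBr (⟨fun g => g f, fun _ _ _ => rfl⟩ :
    HeapHom (HeapHom (LinHom T P N) (Tensor T (Dual T P) N)) (Tensor T (Dual T P) N)) k _

theorem DualBasisProperty.nonempty_iso {P : Type u} [AbHeap P] [TMod T P]
    (h : DualBasisProperty T P) :
    Nonempty (homFunctor T P ≅ tensorFunctor T (Dual T P)) := by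
  obtain ⟨k, e, φ, h⟩ := h
  refine ⟨(NatIso.ofComponents (fun (N : ModCat T) => Iso.mk (X := Ah.mk (Tensor T (Dual T P) N))
    (Y := Ah.mk (LinHom T P N)) (dualTensorHom T P N) (homDualTensor N k e φ) ?_ ?_)
    fun {M N} g => ?_).symm⟩
  · refine TensorBy.hom_ext fun f n => ?_
    change homDualTensor N k e φ (dualTensorHom T P N (tmul T _ N f n)) = tmul T _ N f n
    rw [homDualTensor_apply]
    -- Expanding f in the dual and moving each scalar f(e_i) across the tensor sign turns [φ_i ·
    -- f(e_i)] ⊗ n into [φ_i ⊗ f(e_i) · n].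
    conv_rhs => rw [eq_oddBr_ract_of_dualBasis h f]
    have := HeapHom.map_oddBr (⟨fun f => tmul T (Dual T P) N f n, fun a b c => by simp⟩ :
      HeapHom (Dual T P) (Tensor T (Dual T P) N)) k fun i => ract T (Dual T P) (f (e i)) (φ i)
    refine Eq.trans ?_ this.symm
    exact congrArg (oddBr k) (funext fun i => (tmul_ract (φ i) (f (e i)) n).symm)
  · refine HeapHom.ext fun f => LinHom.ext fun p => ?_
    change dualTensorHom T P N (homDualTensor N k e φ f) p = f p
    rw [homDualTensor_apply, HeapHom.map_oddBr, LinHom.oddBr_apply,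
      eq_oddBr_lact_of_dualBasis h f p]
    rfl
  -- Naturality is checked for the canonical map, which does not involve the chosen basis.
  · refine TensorBy.hom_ext fun f n => LinHom.ext fun p => ?_
    exact (LinHom.map_lact g (f p) n).symm

end Representation

/-! ### The tensor product functor is a left adjoint -/

section Adjunction

variable (T : Type u) [Truss T]

/-- The left `T`-module `Hom(Q, A)`, with `(t · g)(q) = g(q · t)`. -/
instance HeapHom.leftMod (Q : Type v) (A : Type w) [AbHeap Q] [TMod Tᵐᵒᵖ Q] [AbHeap A] :
    TMod T (HeapHom Q A) where
  smul t g := g.comp (TMod.toEnd Tᵐᵒᵖ Q (op t))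
  -- Precomposition reverses the order of the factors, which cancels the reversal in the opposite
  -- truss.
  mul_smul s t g := HeapHom.ext fun q => congrArg g (mul_smul (op t) (op s) q)
  br_smul a b c g := HeapHom.ext fun q =>
    (congrArg g (TMod.br_smul (op a) (op b) (op c) q)).trans (g.map_br _ _ _)
  smul_br _ _ _ _ := rfl

/-- The functor `Hom(Q, -)` from abelian heaps to left `T`-modules. -/
def heapHomFunctor (Q : Type u) [AbHeap Q] [TMod Tᵐᵒᵖ Q] : Ah.{u} ⥤ ModCat T where
  obj A := ⟨HeapHom Q A⟩
  map {A B} (f : HeapHom A B) := (⟨⟨fun g => f.comp g,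
    fun a b c => HeapHom.ext fun q => f.map_br _ _ _⟩, fun _ _ => rfl⟩ :
      LinHom T (HeapHom Q A) (HeapHom Q B))

/-- The tensor-hom adjunction. -/
def tensorAdjunction (Q : Type u) [AbHeap Q] [TMod Tᵐᵒᵖ Q] :
    tensorFunctor T Q ⊣ heapHomFunctor T Q :=
  Adjunction.mkOfHomEquiv
    { homEquiv := fun M A =>
        { toFun := fun (f : HeapHom (Tensor T Q M) A) =>
            (⟨⟨fun m => ⟨fun q => f (tmul T Q M q m), fun a b c => by simp⟩,
              fun a b c => HeapHom.ext fun q => by simp⟩,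
              -- Balancing over `T` corresponds exactly to linearity of the transpose.
              fun t m => HeapHom.ext fun q => congrArg f (tmul_balanced q t m).symm⟩ :
              LinHom T M (HeapHom Q A))
          invFun := fun (g : LinHom T M (HeapHom Q A)) =>
            (Tensor.lift ⟨fun q => ⟨fun m => g m q, fun a b c => by simp⟩,
              fun a b c => HeapHom.ext fun m => (g m).map_br a b c⟩
              (fun q t m => (DFunLike.congr_fun (g.map_smul t m) q).symm) :
              HeapHom (Tensor T Q M) A)
          left_inv := fun f => TensorBy.hom_ext fun q m => rfl
          right_inv := fun g => rfl }
      homEquiv_naturality_left_symm := fun f g => TensorBy.hom_ext fun q m => rfl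
      homEquiv_naturality_right := fun f g => rfl }

end Adjunction

/-! ### Colimits of abelian heaps are generated by their components -/

/-- The elements satisfying `p` form a subheap through which the cocone factors. The induced map
from the colimit, followed by the inclusion, is the identity by uniqueness, so the subheap is
everything. It may a priori be empty, so no base point is required. -/
theorem Ah.isColimit_induction {J : Type v} [Category.{w} J] {F : J ⥤ Ah.{u}} {c : Cocone F}
    (hc : IsColimit c) {p : c.pt → Prop}
    (hι : ∀ (j : J) (x : F.obj j), p (HeapHom.toFun (A := F.obj j) (B := c.pt) (c.ι.app j) x))
    (hbr : ∀ a b c, p a → p b → p c → p (br a b c)) (z : c.pt) : p z := by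
  let _ : AbHeap {z : c.pt // p z} :=
    { br := fun a b c => ⟨br a.1 b.1 c.1, hbr _ _ _ a.2 b.2 c.2⟩
      br_assoc := fun _ _ _ _ _ => Subtype.ext (br_assoc _ _ _ _ _)
      br_right := fun _ _ => Subtype.ext (br_right _ _)
      br_left := fun _ _ => Subtype.ext (br_left _ _)
      br_comm := fun _ _ _ => Subtype.ext (br_comm _ _ _) }
  let S : Ah.{u} := ⟨{z : c.pt // p z}⟩
  let s : Cocone F :=
    { pt := S
      ι :=
        { app := fun j => (⟨fun x => ⟨_, hι j x⟩, fun a b d => Subtype.ext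
            (HeapHom.map_br' (A := F.obj j) (B := c.pt) (c.ι.app j) a b d)⟩ : HeapHom (F.obj j) S)
          naturality := fun i j f => HeapHom.ext fun x => Subtype.ext
            (DFunLike.congr_fun (F := HeapHom (F.obj i) c.pt) (c.ι.naturality f) x) } }
  let incl : S ⟶ c.pt := (⟨Subtype.val, fun _ _ _ => rfl⟩ : HeapHom S c.pt)
  have h : hc.desc s ≫ incl = 𝟙 c.pt := hc.hom_ext fun j => by
    rw [← Category.assoc, hc.fac, Category.comp_id]
    rfl
  have hz := DFunLike.congr_fun (F := HeapHom c.pt c.pt) h z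
  have hz' : incl.toFun ((hc.desc s).toFun z) = z := hz
  rw [← hz']
  exact ((hc.desc s).toFun z).2

/-! ### Free modules -/

section Free

variable (T : Type u) [Truss T]

/-- The free abelian heap on `X`. -/
abbrev FreeHeap (X : Type u) : Type u := Presented fun _ _ : HeapWord X => False

/-- The free `T`-module on `X`, as a module over `T`. -/
abbrev FreeMod (X : Type u) : Type u := HTensor (UExt T) (FreeHeap X)

namespace FreeMod

variable {T} {X : Type u}

/-- The inclusion of the summand `T ⊞ ⋆` with index `x`. -/
def incl (x : X) : LinHom T (UExt T) (FreeMod T X) :=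
  ⟨⟨fun z => htmul _ (FreeHeap X) z (Presented.gen _ x), fun a b c => by simp⟩, fun _ _ => rfl⟩

theorem induction {p : FreeMod T X → Prop} (hi : ∀ x z, p (incl x z))
    (hbr : ∀ a b c, p a → p b → p c → p (br a b c)) (w : FreeMod T X) : p w := by
  refine TensorBy.induction (fun z y => ?_) hbr w
  refine Presented.induction (p := fun y => p (htmul _ _ z y)) (fun x => hi x z) ?_ y
  intro a b c ha hb hc
  rw [HeapHom.map_br]
  exact hbr _ _ _ ha hb hc

variable {N : Type v} [AbHeap N] [TMod T N]

/-- The morphism of modules with prescribed restrictions to the summands. -/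
def desc (f : X → LinHom T (UExt T) N) : LinHom T (FreeMod T X) N where
  toHeapHom := TensorBy.lift
    ⟨fun z => Presented.lift (fun x => f x z) (fun _ _ h => h.elim),
      fun a b c => Presented.hom_ext fun x => (f x).map_br a b c⟩
    (fun _ _ h => h.elim)
  map_smul' t w := by
    induction w using induction with
    | hi x z => exact (f x).map_smul t z
    | hbr a b c ha hb hc =>
      change TensorBy.lift _ _ _ = t • TensorBy.lift _ _ _ at ha hb hc
      change TensorBy.lift _ _ _ = t • TensorBy.lift _ _ _
      simp only [TMod.smul_br, HeapHom.map_br, ha, hb, hc]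

theorem hom_ext {f g : LinHom T (FreeMod T X) N} (h : ∀ x z, f (incl x z) = g (incl x z)) :
    f = g :=
  LinHom.ext fun w => induction (p := fun w => f w = g w) h
    (fun a b c ha hb hc => by simp [ha, hb, hc]) w

variable (T X) in
/-- The free module as a cocone over copies of `T ⊞ ⋆`. -/
def cofan : Cofan fun _ : X => (⟨UExt T⟩ : ModCat T) :=
  Cofan.mk ⟨FreeMod T X⟩ fun x => (incl x : LinHom T (UExt T) (FreeMod T X))

variable (T X) in
/-- The free module is a coproduct of copies of `T ⊞ ⋆`. -/
def isColimitCofan : IsColimit (cofan T X) :=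
  Cofan.IsColimit.mk _ (fun s => desc (N := s.pt) fun x => s.inj x)
    (fun _ _ => rfl)
    (fun s _ h => hom_ext (N := s.pt) fun x z =>
      DFunLike.congr_fun (F := LinHom T (UExt T) s.pt) (h x) z)

end FreeMod

end Free

/-! ### Surjections are coequalizers of their kernel pairs -/

section KernelPair

variable {T : Type u} [Truss T] {M N : Type u} [AbHeap M] [AbHeap N] [TMod T M] [TMod T N]

/-- The kernel pair of a morphism. -/
def KerPair (f : LinHom T M N) : Type u := {q : M × M // f q.1 = f q.2}

instance (f : LinHom T M N) : AbHeap (KerPair f) where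
  br a b c := ⟨(br a.1.1 b.1.1 c.1.1, br a.1.2 b.1.2 c.1.2), by simp [a.2, b.2, c.2]⟩
  br_assoc _ _ _ _ _ := Subtype.ext (Prod.ext (br_assoc _ _ _ _ _) (br_assoc _ _ _ _ _))
  br_right _ _ := Subtype.ext (Prod.ext (br_right _ _) (br_right _ _))
  br_left _ _ := Subtype.ext (Prod.ext (br_left _ _) (br_left _ _))
  br_comm _ _ _ := Subtype.ext (Prod.ext (br_comm _ _ _) (br_comm _ _ _))

instance (f : LinHom T M N) : TMod T (KerPair f) where
  smul t a := ⟨(t • a.1.1, t • a.1.2), by simp [a.2]⟩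
  mul_smul _ _ _ := Subtype.ext (Prod.ext (mul_smul _ _ _) (mul_smul _ _ _))
  br_smul _ _ _ _ := Subtype.ext (Prod.ext (TMod.br_smul _ _ _ _) (TMod.br_smul _ _ _ _))
  smul_br _ _ _ _ := Subtype.ext (Prod.ext (TMod.smul_br _ _ _ _) (TMod.smul_br _ _ _ _))

namespace KerPair

/-- The first projection. -/
def fst (f : LinHom T M N) : LinHom T (KerPair f) M :=
  ⟨⟨fun a => a.1.1, fun _ _ _ => rfl⟩, fun _ _ => rfl⟩

/-- The second projection. -/
def snd (f : LinHom T M N) : LinHom T (KerPair f) M :=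
  ⟨⟨fun a => a.1.2, fun _ _ _ => rfl⟩, fun _ _ => rfl⟩

/-- The factorization through a surjection of a morphism that identifies its kernel pair. -/
noncomputable def desc {f : LinHom T M N} (hf : Function.Surjective f) {K : Type u} [AbHeap K]
    [TMod T K] (g : LinHom T M K) (hg : ∀ a b, f a = f b → g a = g b) : LinHom T N K where
  toFun n := g (Function.surjInv hf n)
  map_br' a b c := by
    -- The chosen preimage of a bracket and the bracket of the chosen preimages have the same image
    -- under `f`, so `g` agrees on them.
    rw [← g.map_br]
    exact hg _ _ (by simp [Function.surjInv_eq])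
  map_smul' t a := by
    rw [← g.map_smul]
    exact hg _ _ (by simp [Function.surjInv_eq])

theorem desc_apply {f : LinHom T M N} (hf : Function.Surjective f) {K : Type u} [AbHeap K]
    [TMod T K] (g : LinHom T M K) (hg : ∀ a b, f a = f b → g a = g b) (m : M) :
    desc hf g hg (f m) = g m :=
  hg _ _ (Function.surjInv_eq hf (f m))

/-- A morphism as a cofork on its kernel pair. -/
def cofork (f : LinHom T M N) :
    Cofork (X := (⟨KerPair f⟩ : ModCat T)) (Y := ⟨M⟩) (fst f) (snd f) :=
  Cofork.ofπ (P := (⟨N⟩ : ModCat T)) f (LinHom.ext fun a => a.2)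

/-- A surjection is a coequalizer of its kernel pair. -/
noncomputable def isColimitCofork {f : LinHom T M N} (hf : Function.Surjective f) :
    IsColimit (cofork f) :=
  Cofork.IsColimit.mk _
    (fun s => desc (K := s.pt) hf s.π fun a b h =>
      DFunLike.congr_fun (F := LinHom T (KerPair f) s.pt) s.condition ⟨(a, b), h⟩)
    (fun s => LinHom.ext fun m => desc_apply (K := s.pt) hf s.π (fun a b h =>
      DFunLike.congr_fun (F := LinHom T (KerPair f) s.pt) s.condition ⟨(a, b), h⟩) m)
    (fun s m h => LinHom.ext fun n => by
      obtain ⟨n, rfl⟩ := hf n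
      refine Eq.trans ?_ (desc_apply (K := s.pt) hf s.π _ n).symm
      exact DFunLike.congr_fun (F := LinHom T M s.pt) h n)

end KerPair

end KernelPair

/-! ### Dual bases from colimit preservation -/

section Preservation

variable {T : Type u} [Truss T] {P : Type u} [AbHeap P] [TMod T P]

/-- Projectivity of `P`: the maps that lift along `f` are closed under brackets and contain the
components of the preserved coequalizer, which generate Hom_T(P, N). -/
theorem exists_comp_eq_of_surjective {M N : Type u} [AbHeap M] [AbHeap N] [TMod T M] [TMod T N]
    [PreservesColimitsOfShape WalkingParallelPair (homFunctor T P)] {f : LinHom T M N}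
    (hf : Function.Surjective f) (g : LinHom T P N) : ∃ s : LinHom T P M, f.comp s = g := by
  refine Ah.isColimit_induction
    (isColimitOfPreserves (homFunctor T P) (KerPair.isColimitCofork hf))
    (p := fun g : LinHom T P N => ∃ s : LinHom T P M, f.comp s = g) ?_ ?_ g
  -- The component at the kernel pair lifts through its first projection; the component at `M`
  -- consists of lifted maps by definition.
  · rintro (_ | _) x
    · exact ⟨(KerPair.fst f).comp x, rfl⟩
    · exact ⟨x, rfl⟩
  · rintro _ _ _ ⟨a, rfl⟩ ⟨b, rfl⟩ ⟨c, rfl⟩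
    exact ⟨br a b c, (LinHom.postcomp f).map_br a b c⟩

/-- The preserved coproduct has copies of the dual as components, and these generate it. For empty
`X` the hypothesis forces Hom_T(P, FreeMod T X) to be empty, so no separate case arises. -/
theorem exists_oddBr_of_homFreeMod {X : Type u}
    [PreservesColimitsOfShape (Discrete X) (homFunctor T P)] (s : LinHom T P (FreeMod T X)) :
    ∃ (k : ℕ) (x : Fin (2 * k + 1) → X) (φ : Fin (2 * k + 1) → Dual T P),
      s = oddBr k fun i => (FreeMod.incl (x i)).comp (φ i) := by
  let j : X × Dual T P → LinHom T P (FreeMod T X) := fun a => (FreeMod.incl a.1).comp a.2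
  have h : OddWord j s := Ah.isColimit_induction
    (isColimitOfPreserves (homFunctor T P) (FreeMod.isColimitCofan T X))
    (p := fun s : LinHom T P (FreeMod T X) => OddWord j s)
    (fun x φ => OddWord.of (f := j) (x.as, φ)) (fun _ _ _ => OddWord.br_mem) s
  obtain ⟨k, a, h⟩ := h.exists_oddBr
  exact ⟨k, fun i => (a i).1, fun i => (a i).2, h⟩

theorem dualBasisProperty_of_preserves {X : Type u} (e : X → P)
    (he : ∀ S : Set P, IsSubmodule T S → Set.range e ⊆ S → S = Set.univ)
    [PreservesColimitsOfShape WalkingParallelPair (homFunctor T P)]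
    [PreservesColimitsOfShape (Discrete X) (homFunctor T P)] : DualBasisProperty T P := by
  let π : LinHom T (FreeMod T X) P := FreeMod.desc fun x => lactHom T (e x)
  have hπ : Function.Surjective π := by
    -- The image of π is a submodule; it contains e(x) as the image of `*` in the summand indexed by
    -- x.
    refine Set.range_eq_univ.mp (he _ ⟨?_, ?_⟩ ?_)
    · rintro _ ⟨a, rfl⟩ _ ⟨b, rfl⟩ _ ⟨c, rfl⟩
      exact ⟨br a b c, π.map_br a b c⟩
    · rintro t _ ⟨a, rfl⟩
      exact ⟨t • a, π.map_smul t a⟩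
    · rintro _ ⟨x, rfl⟩
      exact ⟨FreeMod.incl x UExt.star, rfl⟩
  obtain ⟨s, hs⟩ := exists_comp_eq_of_surjective hπ (LinHom.id T P)
  obtain ⟨k, x, φ, rfl⟩ := exists_oddBr_of_homFreeMod s
  refine ⟨k, fun i => e (x i), φ, fun p => ?_⟩
  -- On the summand x, π is z ↦ z · e(x), so pushing π through the bracket yields [φ_i(p) · e(x_i)].
  have hp : π (oddBr k (fun i => (FreeMod.incl (x i)).comp (φ i)) p) = p :=
    DFunLike.congr_fun hs p
  rw [LinHom.oddBr_apply, ← LinHom.toHeapHom_apply, HeapHom.map_oddBr] at hp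
  exact hp.symm

theorem FinGen.dualBasisProperty (h : FinGen T P) [PreservesFiniteColimits (homFunctor T P)] :
    DualBasisProperty T P := by
  obtain ⟨s, hs⟩ := h
  exact dualBasisProperty_of_preserves (fun x : s => (x : P)) fun S hS h =>
    hs S hS (by simpa using h)

/-- All of `P` serves as the generating family; the bracket expansion then selects finitely many
generators. -/
theorem dualBasisProperty_of_preservesColimits
    [PreservesColimitsOfSize.{u, u} (homFunctor T P)] : DualBasisProperty T P := by
  have : PreservesFiniteColimits (homFunctor T P) :=
    PreservesColimitsOfSize.preservesFiniteColimits _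
  exact dualBasisProperty_of_preserves (fun p : P => p) fun S _ h =>
    Set.eq_univ_of_forall fun p => h ⟨p, rfl⟩

end Preservation

end Trusses

theorem theorem5p4 {T : Type u} [Trusses.Truss T] (P : Type u) [Trusses.AbHeap P]
    [Trusses.TMod T P] :
    List.TFAE [
      CategoryTheory.Limits.PreservesFiniteColimits (Trusses.homFunctor T P) ∧
        Trusses.FinGen T P,
      Trusses.DualBasisProperty T P,
      ∃ (ev : Trusses.BilinHom T (Trusses.HTensor P (Trusses.Dual T P)) (Trusses.UExt T))
        (db : Trusses.HeapHom Unit (Trusses.Tensor T (Trusses.Dual T P) P)),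
        Trusses.zigzagLeft ev db = Trusses.HeapHom.id P ∧
        Trusses.zigzagRight ev db = Trusses.HeapHom.id (Trusses.Dual T P),
      Nonempty (Trusses.homFunctor T P ≅ Trusses.tensorFunctor T (Trusses.Dual T P)),
      CategoryTheory.Limits.PreservesColimitsOfSize.{u, u} (Trusses.homFunctor T P)] := by
  tfae_have 1 → 2 := fun ⟨_, h⟩ => h.dualBasisProperty
  tfae_have 2 → 3 := fun h => h.exists_zigzag
  tfae_have 3 → 2 := fun ⟨ev, db, h, _⟩ => .of_zigzagLeft ev db h
  tfae_have 2 → 4 := fun h => h.nonempty_iso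
  tfae_have 4 → 5 := fun ⟨i⟩ =>
    haveI := (Trusses.tensorAdjunction T (Trusses.Dual T P)).leftAdjoint_preservesColimits
    CategoryTheory.Limits.preservesColimits_of_natIso i.symm
  -- Finite generation is read off from the dual basis.
  tfae_have 5 → 1 := fun _ =>
    ⟨CategoryTheory.Limits.PreservesColimitsOfSize.preservesFiniteColimits _,
      Trusses.dualBasisProperty_of_preservesColimits.finGen⟩
  tfae_finish
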